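/- Let $H$ be a $d$-dimensional complex Hilbert space ($d$ finite), and let $\rho,\sigma$ be density operators on $H$ (positive semidefinite, trace one) with the same spectrum, with spectral decompositions $$\rho=\sum_{i=1}^{m} r_i\sum_{k=1}^{n_i}|r_i^k\rangle\langle r_i^k|,\qquad \sigma=\sum_{i=1}^{m} r_i\sum_{k=1}^{n_i}|s_i^k\rangle\langle s_i^k|,$$ where the eigenvalues $r_1,\dots,r_m$ are pairwise distinct, $n_i\ge 1$, $\sum_{i=1}^m n_i=d$, and $\{|r_i^k\rangle\}_{i,k}$ and $\{|s_i^k\rangle\}_{i,k}$ are orthonormal bases of $H$. Let $$\rho_i=\frac1{n_i}\sum_{k=1}^{n_i}|r_i^k\rangle\langle r_i^k|,\qquad \sigma_i=\frac1{n_i}\sum_{k=1}^{n_i}|s_i^k\rangle\langle s_i^k|$$ be the maximally mixed states on the corresponding eigenspaces. For density operators $\alpha,\beta$ let $\theta_B(\alpha,\beta)=\arccos\mathcal F(\alpha,\beta)$ be the Bures angle, where $\mathcal F(\alpha,\beta)=\operatorname{tr}\sqrt{\sqrt{\alpha}\,\beta\sqrt{\alpha}}$. Let the quantum charging distance $D(\rho,\sigma)$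 be the minimal (infimal) time $T\ge 0$ for which there is a measurable, possibly time-dependent, self-adjoint Hamiltonian $V_t$, $t\in[0,T]$, of operator norm $\|V_t\|=1$ such that $\sigma=U\rho U^\dagger$ with $U=\mathrm{Texp}\left(-i\int_0^T V_t\,dt\right)$, that is, $U=U_T$ where $U_t=1-i\int_0^t V_sU_s\,ds$ for $t\in[0,T]$. Then $$\max_{1\le i\le m}\theta_B(\rho_i,\sigma_i)\le D(\rho,\sigma).$$ -/

import Mathlib

open MeasureTheory InnerProductSpace

noncomputable section

namespace QuantumCharging

variable {H : Type*} [NormedAddCommGroup H] [InnerProductSpace ℂ H]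

/-- The trace of an operator on a finite-dimensional Hilbert space. -/
def opTrace (A : H →L[ℂ] H) : ℂ :=
  LinearMap.trace ℂ H (A : H →ₗ[ℂ] H)

/-- Density operators: positive semidefinite (Loewner order) with unit trace. -/
structure IsDensityOperator (ρ : H →L[ℂ] H) : Prop where
  nonneg : 0 ≤ ρ
  trace_eq_one : opTrace ρ = 1

/-- The operator `∑ i, r i ∑ k, |b i k⟩⟨b i k|`; when `b` is an orthonormal basis, it has
eigenvalue `r i` on the span of the vectors `b i k`. -/
def spectralOperator {m : ℕ} {n : Fin m → ℕ} (r : Fin m → ℝ)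
    (b : (Σ i : Fin m, Fin (n i)) → H) : H →L[ℂ] H :=
  ∑ i, (r i : ℂ) • ∑ k : Fin (n i), rankOne ℂ (b ⟨i, k⟩) (b ⟨i, k⟩)

/-- The maximally mixed state `(1 / N) ∑ k, |e k⟩⟨e k|` on the span of an orthonormal family. -/
def maximallyMixed {N : ℕ} (e : Fin N → H) : H →L[ℂ] H :=
  (N : ℂ)⁻¹ • ∑ k, rankOne ℂ (e k) (e k)

variable [CompleteSpace H]

/-- Uhlmann's fidelity `tr √(√ρ σ √ρ)`; the trace is that of a positive operator, hence real. -/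
def fidelity (ρ σ : H →L[ℂ] H) : ℝ :=
  (opTrace (CFC.sqrt (CFC.sqrt ρ * σ * CFC.sqrt ρ))).re

/-- The Bures angle. -/
def buresAngle (ρ σ : H →L[ℂ] H) : ℝ :=
  Real.arccos (fidelity ρ σ)

/-- A (possibly time-dependent) charging Hamiltonian on `[0, T]`: a measurable family of
self-adjoint operators of operator norm one. -/
structure IsChargingHamiltonian (T : ℝ) (V : ℝ → H →L[ℂ] H) : Prop where
  aestronglyMeasurable : AEStronglyMeasurable V (volume.restrict (Set.Icc 0 T))
  selfAdjoint : ∀ t ∈ Set.Icc 0 T, IsSelfAdjoint (V t)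
  norm_eq_one : ∀ t ∈ Set.Icc 0 T, ‖V t‖ = 1

/-- `U t = Texp (-i ∫₀ᵗ V s ds)` for `t ∈ [0, T]`: the time-ordered exponential is the solution of
the Schrödinger equation `dU/dt = -i V U`, `U 0 = 1`, in integral form
(so that `V` may have jumps). -/
structure IsTimeOrderedExp (T : ℝ) (V U : ℝ → H →L[ℂ] H) : Prop where
  continuousOn : ContinuousOn U (Set.Icc 0 T)
  integral_eq : ∀ t ∈ Set.Icc 0 T, U t = 1 - Complex.I • ∫ s in (0 : ℝ)..t, V s * U s

/-- The times `T` in which some charging Hamiltonian drives `ρ` to `σ`. -/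
def chargingTimes (ρ σ : H →L[ℂ] H) : Set ℝ :=
  {T | 0 ≤ T ∧ ∃ V U : ℝ → H →L[ℂ] H, IsChargingHamiltonian T V ∧ IsTimeOrderedExp T V U ∧
    σ = U T * ρ * star (U T)}

/-- The quantum charging distance: the least time in which a charging Hamiltonian drives
`ρ` to `σ`. -/
def chargingDistance (ρ σ : H →L[ℂ] H) : ℝ :=
  sInf (chargingTimes ρ σ)

end QuantumCharging

end

/-! Let `U` drive `ρ` to `σ` in time `T`. If `T ≥ π` the bound is trivial, since `arccos ≤ π`.
Otherwise, for a unit vector `x`, the curve `U t x` stays on the unit sphere and has speed at most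
one, so `Re ⟪x, U T x⟫ ≥ cos T` (`IsTimeOrderedExp.cos_le_re_inner`). As the `r i` are distinct, `U
T` maps the `i`-th eigenspace of `ρ` into that of `σ`. With `P`, `Q` the projections onto these,
averaging over a basis of the first gives `Re tr (U† Q P) / n i ≥ cos T`. The fidelity is `tr |Q P|
/ n i`, which dominates `Re tr (W Q P) / n i` for every contraction `W`
(`le_fidelity_maximallyMixed`); `W = U†` gives fidelity at least `cos T`. Passing to the infimum
needs a charging time to exist (`chargingTimes_nonempty`). -/

noncomputable section

namespace QuantumCharging

/-! ### Angles and curves on the unit sphere -/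

section Angle

variable {E : Type*} [NormedAddCommGroup E] [InnerProductSpace ℝ E]

/-- A chord subtending the angle `θ` on the unit sphere has length `2 sin (θ / 2)`. -/
theorem angle_le_two_mul_arcsin {u v : E} (hu : ‖u‖ = 1) (hv : ‖v‖ = 1) {δ : ℝ}
    (h : ‖u - v‖ ≤ δ) :
    InnerProductGeometry.angle u v ≤ 2 * Real.arcsin (δ / 2) := by
  set θ := InnerProductGeometry.angle u v with hθ
  have h0 : 0 ≤ θ := InnerProductGeometry.angle_nonneg u v
  have hπ : θ ≤ Real.pi := InnerProductGeometry.angle_le_pi u v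
  have hcos : Real.cos θ = ⟪u, v⟫_ℝ := by
    rw [hθ, InnerProductGeometry.cos_angle, hu, hv]; simp
  have hsq : ‖u - v‖ ^ 2 = 2 - 2 * Real.cos θ := by
    rw [norm_sub_sq_real, hu, hv, hcos]; ring
  have hsin : Real.sin (θ / 2) ^ 2 = (‖u - v‖ / 2) ^ 2 := by
    rw [Real.sin_sq_eq_half_sub, mul_div_cancel₀ θ (two_ne_zero), div_pow, hsq]; ring
  have hs0 : 0 ≤ Real.sin (θ / 2) :=
    Real.sin_nonneg_of_nonneg_of_le_pi (by linarith) (by linarith)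
  have hs : Real.sin (θ / 2) = ‖u - v‖ / 2 :=
    (pow_left_inj₀ hs0 (by positivity) two_ne_zero).1 hsin
  have : θ / 2 ≤ Real.arcsin (δ / 2) := by
    rw [Real.le_arcsin_iff_sin_le' ⟨by linarith [Real.pi_pos], by linarith⟩, hs]
    linarith
  linarith

theorem angle_le_sum_angle (f : ℕ → E) (N : ℕ) (hf : ‖f 0‖ = 1) :
    InnerProductGeometry.angle (f 0) (f N) ≤
      ∑ j ∈ Finset.range N, InnerProductGeometry.angle (f j) (f (j + 1)) := by
  induction N with
  | zero =>
    rw [InnerProductGeometry.angle_self (by rw [← norm_ne_zero_iff, hf]; exact one_ne_zero)]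
    simp
  | succ N ih =>
    rw [Finset.sum_range_succ]
    exact (InnerProductGeometry.angle_le_angle_add_angle _ (f N) _).trans (by gcongr)

/-- This is the difference quotient at `0` of `s ↦ 2 arcsin (T s / 2)`, sampled at `s = 1 / N`. -/
theorem tendsto_mul_arcsin_div (T : ℝ) :
    Filter.Tendsto (fun N : ℕ => (N : ℝ) * (2 * Real.arcsin (T / N / 2))) Filter.atTop
      (nhds T) := by
  have hd : HasDerivAt (fun s : ℝ => 2 * Real.arcsin (T * s / 2)) T 0 := by
    have h1 : HasDerivAt (fun s : ℝ => T * s / 2) (T / 2) 0 := by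
      simpa using ((hasDerivAt_id (0 : ℝ)).const_mul T).div_const 2
    have h2 : HasDerivAt Real.arcsin (1 / √(1 - (T * 0 / 2) ^ 2)) (T * 0 / 2) :=
      Real.hasDerivAt_arcsin (by norm_num) (by norm_num)
    convert! (h2.comp (0 : ℝ) h1).const_mul 2 using 1
    simp [mul_div_cancel₀]
  have hs := hd.tendsto_slope_zero_right
  have hN : Filter.Tendsto (fun N : ℕ => ((N : ℝ))⁻¹) Filter.atTop (nhdsWithin 0 (Set.Ioi 0)) :=
    tendsto_inv_atTop_nhdsGT_zero.comp tendsto_natCast_atTop_atTop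
  refine (hs.comp hN).congr fun N => ?_
  simp [div_eq_mul_inv]

/-- A curve of unit speed on the unit sphere moves by an angle of at most the elapsed time. -/
theorem angle_le_of_unit_speed {ψ : ℝ → E} {T : ℝ} (hT : 0 ≤ T)
    (hψ : ∀ t ∈ Set.Icc 0 T, ‖ψ t‖ = 1)
    (hlip : ∀ s ∈ Set.Icc 0 T, ∀ t ∈ Set.Icc 0 T, s ≤ t → ‖ψ s - ψ t‖ ≤ t - s) :
    InnerProductGeometry.angle (ψ 0) (ψ T) ≤ T := by
  -- Cut `[0, T]` into `N` equal steps, each a chord of length at most `T / N`, and let `N → ∞`.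
  refine ge_of_tendsto (tendsto_mul_arcsin_div T) ?_
  filter_upwards [Filter.eventually_gt_atTop 0] with N hN
  have hN' : (0 : ℝ) < N := by exact_mod_cast hN
  have hmem : ∀ j : ℕ, j ≤ N → T / N * j ∈ Set.Icc 0 T := fun j hj => by
    have : (j : ℝ) ≤ N := by exact_mod_cast hj
    refine ⟨by positivity, ?_⟩
    calc T / N * j ≤ T / N * N := by gcongr
      _ = T := by field_simp
  have h := angle_le_sum_angle (fun j : ℕ => ψ (T / N * j)) N
    (hψ _ (hmem 0 (Nat.zero_le _)))
  have hTN : T / N * N = T := by field_simp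
  simp only [Nat.cast_zero, mul_zero, hTN] at h
  refine h.trans ?_
  rw [← nsmul_eq_mul, ← Finset.card_range N, ← Finset.sum_const, Finset.card_range]
  refine Finset.sum_le_sum fun j hj => ?_
  have hj : j < N := Finset.mem_range.1 hj
  refine angle_le_two_mul_arcsin (hψ _ (hmem _ hj.le)) (hψ _ (hmem _ hj)) ?_
  refine (hlip _ (hmem _ hj.le) _ (hmem _ hj) (by gcongr; simp)).trans (le_of_eq ?_)
  push_cast; ring

end Angle

/-- The quadratic bound forces a zero derivative everywhere. It serves for norm conservation, where
`V` is only measurable and `U` need not be differentiable at every time. -/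
theorem eq_of_abs_sub_le_mul_sq {f : ℝ → ℝ} {a b C : ℝ}
    (h : ∀ s ∈ Set.Icc a b, ∀ t ∈ Set.Icc a b, s ≤ t → |f t - f s| ≤ C * (t - s) ^ 2) :
    ∀ t ∈ Set.Icc a b, f t = f a := by
  have h' : ∀ s ∈ Set.Icc a b, ∀ t ∈ Set.Icc a b, |f t - f s| ≤ C * (t - s) ^ 2 := by
    intro s hs t ht
    rcases le_total s t with hst | hst
    · exact h s hs t ht hst
    · rw [abs_sub_comm, show (t - s) ^ 2 = (s - t) ^ 2 by ring]; exact h t ht s hs hst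
  have hd : ∀ s ∈ Set.Icc a b, HasDerivWithinAt f 0 (Set.Icc a b) s := by
    intro s hs
    rw [hasDerivWithinAt_iff_isLittleO]
    have hO : (fun t => f t - f s - (t - s) • (0 : ℝ)) =O[nhdsWithin s (Set.Icc a b)]
        fun t => (t - s) ^ 2 := by
      refine Asymptotics.IsBigO.of_bound C ?_
      filter_upwards [self_mem_nhdsWithin] with t ht
      simpa using h' s hs t ht
    refine hO.trans_isLittleO ?_
    have := (Asymptotics.isLittleO_pow_sub_sub s (m := 2) (by norm_num)).mono
      (nhdsWithin_le_nhds (s := Set.Icc a b))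
    simpa using this
  refine constant_of_derivWithin_zero (fun s hs => (hd s hs).differentiableWithinAt) ?_
  intro s hs
  have hab : a < b := hs.1.trans_lt hs.2
  exact (hd s ⟨hs.1, hs.2.le⟩).derivWithin
    ((uniqueDiffOn_Icc hab) s ⟨hs.1, hs.2.le⟩)

/-! ### Norm conservation and the speed limit for pure states -/

section Dynamics

variable {H : Type*} [NormedAddCommGroup H] [InnerProductSpace ℂ H]
variable {T : ℝ} {V U : ℝ → H →L[ℂ] H}

theorem IsTimeOrderedExp.apply_zero (hT : 0 ≤ T) (hU : IsTimeOrderedExp T V U) : U 0 = 1 := by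
  simpa using hU.integral_eq 0 ⟨le_rfl, hT⟩

variable [CompleteSpace H]

theorem IsTimeOrderedExp.integrableOn (hV : IsChargingHamiltonian T V)
    (hU : IsTimeOrderedExp T V U) :
    IntegrableOn (fun s => V s * U s) (Set.Icc 0 T) volume := by
  obtain ⟨C, hC⟩ := isCompact_Icc.exists_bound_of_continuousOn hU.continuousOn
  refine Integrable.of_bound (C := C) ?_ ?_
  · exact hV.aestronglyMeasurable.mul (hU.continuousOn.aestronglyMeasurable measurableSet_Icc)
  · filter_upwards [ae_restrict_mem measurableSet_Icc] with s hs
    calc ‖V s * U s‖ ≤ ‖V s‖ * ‖U s‖ := norm_mul_le _ _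
      _ = ‖U s‖ := by rw [hV.norm_eq_one s hs, one_mul]
      _ ≤ C := hC s hs

theorem IsTimeOrderedExp.intervalIntegrable (hV : IsChargingHamiltonian T V)
    (hU : IsTimeOrderedExp T V U) {s t : ℝ} (hs : s ∈ Set.Icc 0 T) (ht : t ∈ Set.Icc 0 T) :
    IntervalIntegrable (fun u => V u * U u) volume s t :=
  ((hU.integrableOn hV).mono_set (Set.uIcc_subset_Icc hs ht)).intervalIntegrable

theorem IsTimeOrderedExp.intervalIntegrable_apply (hV : IsChargingHamiltonian T V)
    (hU : IsTimeOrderedExp T V U) (x : H) {s t : ℝ} (hs : s ∈ Set.Icc 0 T)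
    (ht : t ∈ Set.Icc 0 T) :
    IntervalIntegrable (fun u => V u (U u x)) volume s t := by
  have h := hU.intervalIntegrable hV hs ht
  exact ⟨(ContinuousLinearMap.apply ℂ H x).integrable_comp h.1,
    (ContinuousLinearMap.apply ℂ H x).integrable_comp h.2⟩

theorem IsTimeOrderedExp.apply_sub_apply (hV : IsChargingHamiltonian T V)
    (hU : IsTimeOrderedExp T V U) (x : H) {s t : ℝ} (hs : s ∈ Set.Icc 0 T)
    (ht : t ∈ Set.Icc 0 T) :
    U t x - U s x = -Complex.I • ∫ u in s..t, V u (U u x) := by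
  have h0 : (0 : ℝ) ∈ Set.Icc 0 T := ⟨le_rfl, hs.1.trans hs.2⟩
  have h : U t - U s = -Complex.I • ∫ u in s..t, V u * U u := by
    rw [hU.integral_eq t ht, hU.integral_eq s hs,
      ← intervalIntegral.integral_interval_sub_left (hU.intervalIntegrable hV h0 ht)
        (hU.intervalIntegrable hV h0 hs)]
    module
  have h2 := (ContinuousLinearMap.apply ℂ H x).intervalIntegral_comp_comm
    (hU.intervalIntegrable hV hs ht)
  simp only [ContinuousLinearMap.apply_apply, mul_apply_eq_comp] at h2
  rw [h2, ← sub_apply, h, smul_apply]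

theorem IsTimeOrderedExp.norm_sub_le (hV : IsChargingHamiltonian T V)
    (hU : IsTimeOrderedExp T V U) (x : H) {M : ℝ} (hM : ∀ t ∈ Set.Icc 0 T, ‖U t x‖ ≤ M)
    {s t : ℝ} (hs : s ∈ Set.Icc 0 T) (ht : t ∈ Set.Icc 0 T) (hst : s ≤ t) :
    ‖U t x - U s x‖ ≤ M * (t - s) := by
  rw [hU.apply_sub_apply hV x hs ht, norm_smul, norm_neg, Complex.norm_I, one_mul,
    ← abs_of_nonneg (sub_nonneg.2 hst)]
  refine intervalIntegral.norm_integral_le_of_norm_le_const fun u hu => ?_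
  rw [Set.uIoc_of_le hst] at hu
  have hu' : u ∈ Set.Icc 0 T := ⟨hs.1.trans hu.1.le, hu.2.trans ht.2⟩
  calc ‖V u (U u x)‖ ≤ ‖V u‖ * ‖U u x‖ := (V u).le_opNorm _
    _ = ‖U u x‖ := by rw [hV.norm_eq_one u hu', one_mul]
    _ ≤ M := hM u hu'

theorem re_inner_neg_I_smul_selfAdjoint {A : H →L[ℂ] H} (hA : IsSelfAdjoint A) (y : H) :
    (⟪y, -Complex.I • A y⟫_ℂ).re = 0 := by
  have h : (⟪y, A y⟫_ℂ).im = 0 := by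
    have := hA.isSymmetric.im_inner_self_apply y
    rw [← inner_conj_symm]
    simpa using this
  rw [inner_smul_right]
  simp [h]

/-- The first-order term vanishes by self-adjointness. The cross term leaves `2 M²` and the squared
increment `M²`, whence the `3`. -/
theorem IsTimeOrderedExp.abs_norm_sq_sub_le (hV : IsChargingHamiltonian T V)
    (hU : IsTimeOrderedExp T V U) (x : H) {M : ℝ} (hM : ∀ t ∈ Set.Icc 0 T, ‖U t x‖ ≤ M)
    {s t : ℝ} (hs : s ∈ Set.Icc 0 T) (ht : t ∈ Set.Icc 0 T) (hst : s ≤ t) :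
    |‖U t x‖ ^ 2 - ‖U s x‖ ^ 2| ≤ 3 * M ^ 2 * (t - s) ^ 2 := by
  have hM0 : 0 ≤ M := (norm_nonneg _).trans (hM s hs)
  have hts : 0 ≤ t - s := sub_nonneg.2 hst
  have hδ := hU.norm_sub_le hV x hM hs ht hst
  set δ := U t x - U s x with hδd
  have hexp : ‖U t x‖ ^ 2 - ‖U s x‖ ^ 2 = 2 * (⟪U s x, δ⟫_ℂ).re + ‖δ‖ ^ 2 := by
    have h1 : U t x = U s x + δ := by rw [hδd]; abel
    rw [h1, norm_add_sq (𝕜 := ℂ)]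
    simp only [RCLike.re_eq_complex_re]
    ring
  have hre : |(⟪U s x, δ⟫_ℂ).re| ≤ M * (M * (t - s)) * (t - s) := by
    let L : H →L[ℝ] ℝ := Complex.reCLM ∘L (innerSL ℂ (U s x)).restrictScalars ℝ
    have hL : ∀ y, L y = (⟪U s x, y⟫_ℂ).re := fun y => rfl
    have hint : IntervalIntegrable (fun u => -Complex.I • V u (U u x)) volume s t :=
      (hU.intervalIntegrable_apply hV x hs ht).smul (-Complex.I)
    rw [← hL, hδd, hU.apply_sub_apply hV x hs ht, ← intervalIntegral.integral_smul,
      ← L.intervalIntegral_comp_comm hint, ← Real.norm_eq_abs]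
    refine (intervalIntegral.norm_integral_le_of_norm_le_const fun u hu => ?_).trans_eq
      (by rw [abs_of_nonneg hts])
    rw [Set.uIoc_of_le hst] at hu
    have hu' : u ∈ Set.Icc 0 T := ⟨hs.1.trans hu.1.le, hu.2.trans ht.2⟩
    -- Subtracting `U s x` inside `V u` is free, as that contribution is purely imaginary, and gains
    -- a factor `t - s`.
    have h2 : L (-Complex.I • V u (U u x)) = (⟪U s x, -Complex.I • V u (U u x - U s x)⟫_ℂ).re := by
      rw [hL, map_sub, smul_sub, inner_sub_right, Complex.sub_re,
        re_inner_neg_I_smul_selfAdjoint (hV.selfAdjoint u hu'), sub_zero]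
    rw [h2, Real.norm_eq_abs]
    calc _ ≤ ‖⟪U s x, -Complex.I • V u (U u x - U s x)⟫_ℂ‖ := Complex.abs_re_le_norm _
      _ ≤ ‖U s x‖ * ‖-Complex.I • V u (U u x - U s x)‖ := norm_inner_le_norm _ _
      _ ≤ M * (M * (t - s)) := by
        refine mul_le_mul (hM s hs) ?_ (norm_nonneg _) hM0
        rw [norm_smul, norm_neg, Complex.norm_I, one_mul]
        calc _ ≤ ‖V u‖ * ‖U u x - U s x‖ := (V u).le_opNorm _
          _ = ‖U u x - U s x‖ := by rw [hV.norm_eq_one u hu', one_mul]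
          _ ≤ M * (u - s) := hU.norm_sub_le hV x hM hs hu' hu.1.le
          _ ≤ M * (t - s) := by gcongr; exact hu.2
  rw [hexp]
  have hδ2 : ‖δ‖ ^ 2 ≤ (M * (t - s)) ^ 2 := by gcongr
  rw [abs_le] at hre ⊢
  constructor <;> nlinarith [sq_nonneg ‖δ‖, hre.1, hre.2]

/-- The time-ordered exponential of a charging Hamiltonian preserves norms. -/
theorem IsTimeOrderedExp.norm_apply (hV : IsChargingHamiltonian T V)
    (hU : IsTimeOrderedExp T V U) (x : H) {t : ℝ} (ht : t ∈ Set.Icc 0 T) :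
    ‖U t x‖ = ‖x‖ := by
  obtain ⟨M, hM⟩ := isCompact_Icc.exists_bound_of_continuousOn
    (hU.continuousOn.clm_apply (continuousOn_const (c := x)))
  have h := eq_of_abs_sub_le_mul_sq (f := fun t => ‖U t x‖ ^ 2)
    (fun s hs t ht hst => hU.abs_norm_sq_sub_le hV x hM hs ht hst) t ht
  simp only [hU.apply_zero (ht.1.trans ht.2), one_apply_eq_self] at h
  exact (pow_left_inj₀ (norm_nonneg _) (norm_nonneg _) two_ne_zero).1 h

/-- Quantum speed limit for pure states. -/
theorem IsTimeOrderedExp.cos_le_re_inner (hT : 0 ≤ T) (hTπ : T ≤ Real.pi)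
    (hV : IsChargingHamiltonian T V) (hU : IsTimeOrderedExp T V U) {x : H} (hx : ‖x‖ = 1) :
    Real.cos T ≤ (⟪x, U T x⟫_ℂ).re := by
  have hnorm : ∀ t ∈ Set.Icc 0 T, ‖U t x‖ = 1 := fun t ht => (hU.norm_apply hV x ht).trans hx
  -- The angle is that of the real inner product `Re ⟪·, ·⟫`.
  let : InnerProductSpace ℝ H := InnerProductSpace.rclikeToReal ℂ H
  have h := angle_le_of_unit_speed (ψ := fun t => U t x) hT hnorm fun s hs t ht hst => by
    rw [norm_sub_rev, ← one_mul (t - s)]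
    exact hU.norm_sub_le hV x (fun t ht => (hnorm t ht).le) hs ht hst
  have h2 := Real.cos_le_cos_of_nonneg_of_le_pi (InnerProductGeometry.angle_nonneg _ _) hTπ h
  simp only [hU.apply_zero hT, one_apply_eq_self] at h2
  rw [InnerProductGeometry.cos_angle, hx, hnorm T ⟨hT, le_rfl⟩, mul_one, div_one] at h2
  exact h2

end Dynamics

/-! ### Fidelity of maximally mixed states -/

section Fidelity

variable {H : Type*} [NormedAddCommGroup H] [InnerProductSpace ℂ H]

theorem sum_rankOne_apply {ι : Type*} [Fintype ι] {e : ι → H} (x : H) :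
    (∑ k, rankOne ℂ (e k) (e k)) x = ∑ k, ⟪e k, x⟫_ℂ • e k := by
  simp

theorem sum_rankOne_mul_self {ι : Type*} [Fintype ι] {e : ι → H} (he : Orthonormal ℂ e) :
    (∑ k, rankOne ℂ (e k) (e k)) * (∑ k, rankOne ℂ (e k) (e k)) =
      ∑ k, rankOne ℂ (e k) (e k) := by
  classical
  ext x
  simp only [mul_apply_eq_comp, sum_rankOne_apply, inner_sum, inner_smul_right,
    orthonormal_iff_ite.1 he]
  simp

theorem spectralOperator_apply_basis {m : ℕ} {n : Fin m → ℕ} (r : Fin m → ℝ)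
    (b : OrthonormalBasis (Σ i : Fin m, Fin (n i)) ℂ H) (j : Σ i : Fin m, Fin (n i)) :
    spectralOperator r b (b j) = (r j.1 : ℂ) • b j := by
  classical
  have h : ∀ i, (∑ k : Fin (n i), ⟪b ⟨i, k⟩, b j⟫_ℂ • b ⟨i, k⟩) = if i = j.1 then b j else 0 := by
    intro i
    obtain ⟨j, l⟩ := j
    split_ifs with hi
    · subst hi
      simp [orthonormal_iff_ite.1 b.orthonormal]
    · refine Finset.sum_eq_zero fun k _ => ?_
      rw [b.orthonormal.inner_eq_zero (fun hh => hi (congrArg Sigma.fst hh)), zero_smul]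
  simp [spectralOperator, h]

variable [CompleteSpace H]

theorem sum_rankOne_nonneg {ι : Type*} [Fintype ι] (e : ι → H) :
    0 ≤ ∑ k, rankOne ℂ (e k) (e k) :=
  Finset.sum_nonneg fun k _ => by
    rw [ContinuousLinearMap.nonneg_iff_isPositive]
    exact isPositive_rankOne_self (e k)

/-- If `X† X = A`, then `Re tr (W X) ≤ tr √A` for every contraction `W`. -/
theorem re_opTrace_mul_le_opTrace_sqrt [FiniteDimensional ℂ H] {A X W : H →L[ℂ] H}
    (hA : star X * X = A) (hW : ‖W‖ ≤ 1) :
    (opTrace (W * X)).re ≤ (opTrace (CFC.sqrt A)).re := by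
  have hA0 : 0 ≤ A := hA ▸ star_mul_self_nonneg X
  set S := CFC.sqrt A with hS
  have hS0 : 0 ≤ S := CFC.sqrt_nonneg A
  have hSS : S * S = A := CFC.sqrt_mul_sqrt_self A hA0
  have hSpos : S.IsPositive := (ContinuousLinearMap.nonneg_iff_isPositive S).1 hS0
  have hSsa : star S = S := hS0.isSelfAdjoint
  have hSsym : (S : H →ₗ[ℂ] H).IsSymmetric := hSpos.isSymmetric
  have hnorm : ∀ x, ‖X x‖ = ‖S x‖ := by
    intro x
    have h1 : ⟪X x, X x⟫_ℂ = ⟪S x, S x⟫_ℂ := by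
      rw [← ContinuousLinearMap.adjoint_inner_right X, ← ContinuousLinearMap.adjoint_inner_right S,
        ← ContinuousLinearMap.star_eq_adjoint, ← ContinuousLinearMap.star_eq_adjoint, hSsa,
        ← mul_apply_eq_comp, ← mul_apply_eq_comp, hA, hSS]
    rw [norm_eq_sqrt_re_inner (𝕜 := ℂ), h1, ← norm_eq_sqrt_re_inner]
  -- In an eigenbasis of `S`, `‖X e‖ = ‖S e‖ = ⟪e, S e⟫`, so the traces compare term by term.
  let e := hSsym.eigenvectorBasis rfl
  rw [opTrace, opTrace, LinearMap.trace_eq_sum_inner _ e, LinearMap.trace_eq_sum_inner _ e,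
    Complex.re_sum, Complex.re_sum]
  refine Finset.sum_le_sum fun i _ => ?_
  have he : S (e i) = (hSsym.eigenvalues rfl i : ℂ) • e i := hSsym.apply_eigenvectorBasis rfl i
  have hei : ‖e i‖ = 1 := e.norm_eq_one i
  have hinner : ⟪e i, S (e i)⟫_ℂ = (hSsym.eigenvalues rfl i : ℂ) := by
    rw [he, inner_smul_right, inner_self_eq_norm_sq_to_K, hei]; simp
  have hev : 0 ≤ hSsym.eigenvalues rfl i := by
    have := hSpos.re_inner_nonneg_right (e i)
    rw [hinner] at this
    simpa using this
  have hSe : ‖S (e i)‖ = hSsym.eigenvalues rfl i := by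
    rw [he, norm_smul, hei, Complex.norm_real, Real.norm_of_nonneg hev, mul_one]
  calc (⟪e i, (W * X) (e i)⟫_ℂ).re ≤ ‖⟪e i, (W * X) (e i)⟫_ℂ‖ := Complex.re_le_norm _
    _ ≤ ‖e i‖ * ‖W (X (e i))‖ := norm_inner_le_norm _ _
    _ ≤ 1 * (1 * ‖X (e i)‖) := by
      rw [hei]; gcongr; exact W.le_of_opNorm_le hW _
    _ = (⟪e i, S (e i)⟫_ℂ).re := by rw [hnorm, hSe, hinner]; simp

theorem sqrt_maximallyMixed {N : ℕ} {e : Fin N → H} (he : Orthonormal ℂ e) :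
    CFC.sqrt (maximallyMixed e) = ((√N)⁻¹ : ℝ) • ∑ k, rankOne ℂ (e k) (e k) := by
  refine CFC.sqrt_unique ?_ (smul_nonneg (by positivity) (sum_rankOne_nonneg e))
  rw [smul_mul_smul_comm, sum_rankOne_mul_self he, ← mul_inv, Real.mul_self_sqrt (by positivity),
    maximallyMixed, ← Complex.coe_smul]
  simp

/-- A contraction bounds the fidelity of two maximally mixed states from below. -/
theorem le_fidelity_maximallyMixed [FiniteDimensional ℂ H] {N : ℕ} {e f : Fin N → H}
    (he : Orthonormal ℂ e) (hf : Orthonormal ℂ f) {W : H →L[ℂ] H} (hW : ‖W‖ ≤ 1) :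
    (N : ℝ)⁻¹ * (opTrace (W * ((∑ k, rankOne ℂ (f k) (f k)) * ∑ k, rankOne ℂ (e k) (e k)))).re ≤
      fidelity (maximallyMixed e) (maximallyMixed f) := by
  set P := ∑ k, rankOne ℂ (e k) (e k) with hP
  set Q := ∑ k, rankOne ℂ (f k) (f k) with hQ
  have hPs : star P = P := (sum_rankOne_nonneg e).isSelfAdjoint
  have hQs : star Q = Q := (sum_rankOne_nonneg f).isSelfAdjoint
  have hQQ : Q * Q = Q := sum_rankOne_mul_self hf
  have hX : star ((N : ℂ)⁻¹ • (Q * P)) * ((N : ℂ)⁻¹ • (Q * P)) =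
      CFC.sqrt (maximallyMixed e) * maximallyMixed f * CFC.sqrt (maximallyMixed e) := by
    have h1 : CFC.sqrt (maximallyMixed e) = (((√N)⁻¹ : ℝ) : ℂ) • P := by
      rw [sqrt_maximallyMixed he, Complex.coe_smul]
    have h2 : (((√N)⁻¹ : ℝ) : ℂ) * (((√N)⁻¹ : ℝ) : ℂ) = (N : ℂ)⁻¹ := by
      rw [← Complex.ofReal_mul, ← mul_inv, Real.mul_self_sqrt (by positivity)]; simp
    have h3 : P * Q * (Q * P) = P * Q * P := by
      rw [← mul_assoc, mul_assoc P Q Q, hQQ]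
    rw [h1, maximallyMixed, ← hQ, star_smul, star_mul, hPs, hQs]
    simp only [smul_mul_smul_comm, h3]
    congr 1
    rw [mul_right_comm, h2]; simp
  have h := re_opTrace_mul_le_opTrace_sqrt hX hW
  rw [fidelity]
  refine le_trans (le_of_eq ?_) h
  rw [mul_smul_comm, opTrace, opTrace, ContinuousLinearMap.toLinearMap_smul, map_smul, smul_eq_mul,
    ← Complex.ofReal_natCast, ← Complex.ofReal_inv, Complex.re_ofReal_mul]

end Fidelity

/-! ### Existence of a charging time -/

section Existence

variable {H : Type*} [NormedAddCommGroup H] [InnerProductSpace ℂ H] [CompleteSpace H]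

/-- Every unitary operator on a finite-dimensional Hilbert space has a self-adjoint logarithm. -/
theorem exists_isSelfAdjoint_exp_eq [FiniteDimensional ℂ H] {W : H →L[ℂ] H}
    (hW : W ∈ unitary (H →L[ℂ] H)) :
    ∃ K : H →L[ℂ] H, IsSelfAdjoint K ∧ NormedSpace.exp (Complex.I • K) = W := by
  -- On a finite spectrum every function is continuous, so the branch cut of `arg` does no harm.
  have hfin : (spectrum ℂ W).Finite := by
    rw [← AlgEquiv.spectrum_eq (Module.End.toContinuousLinearMap H).symm W]
    exact Module.End.finite_spectrum _
  have hcont : ∀ f : ℂ → ℂ, ContinuousOn f (spectrum ℂ W) := fun f => hfin.continuousOn f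
  have hWn : IsStarNormal W := isStarNormal_of_mem_unitary hW
  let K : H →L[ℂ] H := cfc (fun z : ℂ => (z.arg : ℂ)) W
  have hK : IsSelfAdjoint K := by
    rw [isSelfAdjoint_iff, ← cfc_star]
    exact cfc_congr fun z _ => by simp
  refine ⟨K, hK, ?_⟩
  have hI : Complex.I • K = cfc (fun z : ℂ => Complex.I * (z.arg : ℂ)) W := by
    rw [← cfc_const_mul Complex.I _ W (hcont _)]
  have hn : IsStarNormal (Complex.I • K) := by rw [hI]; exact cfc_predicate _ _
  rw [← CFC.complex_exp_eq_normedSpace_exp hn, hI, ← cfc_comp' _ _ W ?_ (hcont _)]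
  · conv_rhs => rw [← cfc_id' ℂ W]
    refine cfc_congr fun z hz => ?_
    have hz1 : ‖z‖ = 1 := by
      simpa using spectrum.subset_circle_of_unitary hW hz
    have := Complex.norm_mul_exp_arg_mul_I z
    rw [hz1] at this
    simpa [mul_comm] using this
  · exact Complex.continuous_exp.continuousOn

/-- The constant Hamiltonian `-K / ‖K‖` runs for time `‖K‖`; if `K = 0`, any Hamiltonian of norm one
runs for time zero. -/
theorem exists_charging_of_isSelfAdjoint [Nontrivial H] {K : H →L[ℂ] H} (hK : IsSelfAdjoint K) :
    ∃ T : ℝ, 0 ≤ T ∧ ∃ V U : ℝ → H →L[ℂ] H, IsChargingHamiltonian T V ∧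
      IsTimeOrderedExp T V U ∧ U T = NormedSpace.exp (Complex.I • K) := by
  obtain ⟨L, hL, hL1, hLK⟩ : ∃ L : H →L[ℂ] H, IsSelfAdjoint L ∧ ‖L‖ = 1 ∧ K = -(‖K‖ • L) := by
    rcases eq_or_ne K 0 with rfl | h0
    · exact ⟨1, .one _, norm_one, by simp⟩
    · have h : ‖K‖ ≠ 0 := norm_ne_zero_iff.2 h0
      refine ⟨-(‖K‖⁻¹ • K), (IsSelfAdjoint.smul (IsSelfAdjoint.all ‖K‖⁻¹) hK).neg, ?_, ?_⟩
      · rw [norm_neg, norm_smul, norm_inv, norm_norm, inv_mul_cancel₀ h]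
      · rw [smul_neg, neg_neg, smul_smul, mul_inv_cancel₀ h, one_smul]
  let B : H →L[ℂ] H := -Complex.I • L
  have hd : ∀ t : ℝ, HasDerivAt (fun s : ℝ => NormedSpace.exp (s • B))
      (B * NormedSpace.exp (t • B)) t := fun t => hasDerivAt_exp_smul_const' B t
  have hc : Continuous fun s : ℝ => NormedSpace.exp (s • B) :=
    continuous_iff_continuousAt.2 fun t => (hd t).continuousAt
  refine ⟨‖K‖, norm_nonneg K, fun _ => L, fun t => NormedSpace.exp (t • B),
    ⟨aestronglyMeasurable_const, fun _ _ => hL, fun _ _ => hL1⟩, ⟨hc.continuousOn, ?_⟩, ?_⟩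
  · intro t _
    have h := intervalIntegral.integral_eq_sub_of_hasDerivAt (a := 0) (b := t)
      (fun s _ => hd s) ((continuous_const.mul hc).intervalIntegrable _ _)
    have h2 : (fun s : ℝ => B * NormedSpace.exp (s • B)) =
        fun s : ℝ => -Complex.I • (L * NormedSpace.exp (s • B)) := by
      funext s; rw [smul_mul_assoc]
    rw [h2, intervalIntegral.integral_smul, zero_smul, NormedSpace.exp_zero] at h
    rw [sub_eq_add_neg, ← neg_smul, h]
    abel
  · show NormedSpace.exp (‖K‖ • B) = _
    congr 1
    conv_rhs => rw [hLK]
    rw [smul_neg, ← neg_smul, smul_comm]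

/-- Needed because `sInf ∅ = 0` would make the lower bound fail. -/
theorem chargingTimes_nonempty [FiniteDimensional ℂ H] [Nontrivial H] {m : ℕ} {n : Fin m → ℕ}
    (r : Fin m → ℝ) (a b : OrthonormalBasis (Σ i : Fin m, Fin (n i)) ℂ H) :
    (chargingTimes (spectralOperator r a) (spectralOperator r b)).Nonempty := by
  let e : H ≃ₗᵢ[ℂ] H := a.equiv b (Equiv.refl _)
  let W : unitary (H →L[ℂ] H) := Unitary.linearIsometryEquiv.symm e
  have hWa : ∀ j, (W : H →L[ℂ] H) (a j) = b j := fun j => by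
    show e (a j) = b j
    simp [e]
  obtain ⟨K, hK, hKW⟩ := exists_isSelfAdjoint_exp_eq W.2
  obtain ⟨T, hT, V, U, hV, hU, hUT⟩ := exists_charging_of_isSelfAdjoint hK
  refine ⟨T, hT, V, U, hV, hU, ?_⟩
  rw [hUT, hKW]
  have h : spectralOperator r b * (W : H →L[ℂ] H) = (W : H →L[ℂ] H) * spectralOperator r a := by
    refine ContinuousLinearMap.coe_injective (a.toBasis.ext fun j => ?_)
    simp only [a.coe_toBasis]
    show spectralOperator r b ((W : H →L[ℂ] H) (a j)) =
      (W : H →L[ℂ] H) (spectralOperator r a (a j))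
    rw [spectralOperator_apply_basis, map_smul, hWa, spectralOperator_apply_basis]
  rw [← h, mul_assoc, Unitary.mul_star_self_of_mem W.2, mul_one]

end Existence

/-! ### The lower bound for a given charging time -/

section Bound

variable {H : Type*} [NormedAddCommGroup H] [InnerProductSpace ℂ H] [CompleteSpace H]

theorem isSelfAdjoint_spectralOperator {m : ℕ} {n : Fin m → ℕ} (r : Fin m → ℝ)
    (b : (Σ i : Fin m, Fin (n i)) → H) : IsSelfAdjoint (spectralOperator r b) := by
  rw [spectralOperator]
  refine isSelfAdjoint_sum _ fun i _ => ?_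
  rw [Complex.coe_smul]
  exact IsSelfAdjoint.smul (IsSelfAdjoint.all (r i)) (sum_rankOne_nonneg _).isSelfAdjoint

theorem buresAngle_le_of_mem_chargingTimes [FiniteDimensional ℂ H] {m : ℕ} {n : Fin m → ℕ}
    (hn : ∀ i, 0 < n i) {r : Fin m → ℝ} (hr : Function.Injective r)
    (a b : OrthonormalBasis (Σ i : Fin m, Fin (n i)) ℂ H) {T : ℝ}
    (hT : T ∈ chargingTimes (spectralOperator r a) (spectralOperator r b)) (i : Fin m) :
    buresAngle (maximallyMixed fun k : Fin (n i) => a ⟨i, k⟩)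
      (maximallyMixed fun k : Fin (n i) => b ⟨i, k⟩) ≤ T := by
  obtain ⟨hT0, V, U, hV, hU, hσ⟩ := hT
  rcases le_total Real.pi T with hπ | hπ
  · exact (Real.arccos_le_pi _).trans hπ
  have hinj : ∀ j : Fin m, Function.Injective fun k : Fin (n j) => (⟨j, k⟩ : Σ i, Fin (n i)) :=
    fun j => sigma_mk_injective (β := fun i => Fin (n i))
  have hnorm : ∀ x, ‖U T x‖ = ‖x‖ := fun x => hU.norm_apply hV x ⟨hT0, le_rfl⟩
  have hiso : star (U T) * U T = 1 := (U T).norm_map_iff_adjoint_comp_self.1 hnorm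
  have hUnorm : ‖U T‖ ≤ 1 :=
    ContinuousLinearMap.opNorm_le_bound _ zero_le_one fun x => by rw [hnorm, one_mul]
  have hWnorm : ‖star (U T)‖ ≤ 1 := by rwa [norm_star]
  have hcomm : spectralOperator r b * U T = U T * spectralOperator r a := by
    rw [hσ, mul_assoc, hiso, mul_one]
  set Q := ∑ k, rankOne ℂ (b ⟨i, k⟩) (b ⟨i, k⟩) with hQ
  set P := ∑ k, rankOne ℂ (a ⟨i, k⟩) (a ⟨i, k⟩) with hP
  -- `U T` maps the eigenspaces of `ρ` to those of `σ`
  have hoff : ∀ (k : Fin (n i)) (j : Fin m) (l : Fin (n j)), j ≠ i →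
      ⟪b ⟨j, l⟩, U T (a ⟨i, k⟩)⟫_ℂ = 0 := by
    intro k j l hj
    have h1 : spectralOperator r b (U T (a ⟨i, k⟩)) = (r i : ℂ) • U T (a ⟨i, k⟩) := by
      rw [← mul_apply_eq_comp, hcomm, mul_apply_eq_comp, spectralOperator_apply_basis, map_smul]
    have h2 : ⟪spectralOperator r b (b ⟨j, l⟩), U T (a ⟨i, k⟩)⟫_ℂ =
        ⟪b ⟨j, l⟩, spectralOperator r b (U T (a ⟨i, k⟩))⟫_ℂ :=
      (isSelfAdjoint_spectralOperator r b).isSymmetric _ _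
    rw [h1, spectralOperator_apply_basis, inner_smul_left, inner_smul_right, Complex.conj_ofReal,
      mul_eq_mul_right_iff] at h2
    exact h2.resolve_left fun h => hj (hr (Complex.ofReal_injective h))
  -- Only the `i`-th block survives in the expansion of `U T (a ⟨i, k⟩)` in the basis `b`.
  have hQU : ∀ k : Fin (n i), Q (U T (a ⟨i, k⟩)) = U T (a ⟨i, k⟩) := by
    intro k
    conv_rhs => rw [← b.sum_repr' (U T (a ⟨i, k⟩)), Fintype.sum_sigma]
    rw [Finset.sum_eq_single i, hQ, sum_rankOne_apply]
    · exact fun j _ hj => Finset.sum_eq_zero fun l _ => by rw [hoff k j l hj, zero_smul]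
    · simp
  have hQs : star Q = Q := (sum_rankOne_nonneg _).isSelfAdjoint
  have htrace : (opTrace (star (U T) * (Q * P))).re =
      ∑ k : Fin (n i), (⟪a ⟨i, k⟩, U T (a ⟨i, k⟩)⟫_ℂ).re := by
    rw [opTrace, LinearMap.trace_eq_sum_inner _ a, Fintype.sum_sigma, Finset.sum_eq_single i,
      Complex.re_sum]
    · refine Finset.sum_congr rfl fun k _ => ?_
      have hPa : P (a ⟨i, k⟩) = a ⟨i, k⟩ := by
        classical
        rw [hP, sum_rankOne_apply]
        simp [orthonormal_iff_ite.1 a.orthonormal]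
      show (⟪a ⟨i, k⟩, star (U T) (Q (P (a ⟨i, k⟩)))⟫_ℂ).re = _
      rw [hPa, ContinuousLinearMap.star_eq_adjoint, ContinuousLinearMap.adjoint_inner_right,
        ← ContinuousLinearMap.adjoint_inner_left, ← ContinuousLinearMap.star_eq_adjoint, hQs, hQU,
        ← inner_conj_symm, Complex.conj_re]
    · intro j _ hj
      refine Finset.sum_eq_zero fun l _ => ?_
      have hPa : P (a ⟨j, l⟩) = 0 := by
        rw [hP, sum_rankOne_apply]
        refine Finset.sum_eq_zero fun k _ => ?_
        rw [a.orthonormal.inner_eq_zero (fun h => hj (congrArg Sigma.fst h).symm), zero_smul]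
      show ⟪a ⟨j, l⟩, star (U T) (Q (P (a ⟨j, l⟩)))⟫_ℂ = 0
      rw [hPa, map_zero, map_zero, inner_zero_right]
    · simp
  have hF := le_fidelity_maximallyMixed (a.orthonormal.comp _ (hinj i))
    (b.orthonormal.comp _ (hinj i)) hWnorm
  have hsum : (n i : ℝ) * Real.cos T ≤ ∑ k : Fin (n i), (⟪a ⟨i, k⟩, U T (a ⟨i, k⟩)⟫_ℂ).re := by
    have := Finset.card_nsmul_le_sum Finset.univ
      (fun k : Fin (n i) => (⟪a ⟨i, k⟩, U T (a ⟨i, k⟩)⟫_ℂ).re) (Real.cos T)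
      fun k _ => hU.cos_le_re_inner hT0 hπ hV (a.norm_eq_one _)
    simpa using this
  have hni : (0 : ℝ) < n i := by exact_mod_cast hn i
  have hcos : Real.cos T ≤ fidelity (maximallyMixed fun k : Fin (n i) => a ⟨i, k⟩)
      (maximallyMixed fun k : Fin (n i) => b ⟨i, k⟩) := by
    refine le_trans ?_ hF
    simp only [Function.comp_apply]
    rw [← hP, ← hQ, htrace, inv_mul_eq_div, le_div_iff₀ hni, mul_comm]
    exact hsum
  calc _ ≤ Real.arccos (Real.cos T) := Real.antitone_arccos hcos
    _ = T := Real.arccos_cos hT0 hπ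

end Bound

end QuantumCharging

end

theorem corollary2 {H : Type*} [NormedAddCommGroup H] [InnerProductSpace ℂ H]
    [FiniteDimensional ℂ H] [CompleteSpace H]
    (ρ σ : H →L[ℂ] H)
    (hρ : QuantumCharging.IsDensityOperator ρ) (hσ : QuantumCharging.IsDensityOperator σ)
    (m : ℕ) (n : Fin m → ℕ) (hn : ∀ i, 0 < n i)
    (r : Fin m → ℝ) (hr : Function.Injective r)
    (a b : OrthonormalBasis (Σ i : Fin m, Fin (n i)) ℂ H)
    (hρa : ρ = QuantumCharging.spectralOperator r a)
    (hσb : σ = QuantumCharging.spectralOperator r b) :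
    (⨆ i : Fin m, QuantumCharging.buresAngle
        (QuantumCharging.maximallyMixed fun k : Fin (n i) => a ⟨i, k⟩)
        (QuantumCharging.maximallyMixed fun k : Fin (n i) => b ⟨i, k⟩))
      ≤ QuantumCharging.chargingDistance ρ σ := by
  -- Unit trace excludes `H = 0`. Hence norm-one Hamiltonians exist and the supremum runs over a
  -- nonempty index set.
  have hH : Nontrivial H := by
    by_contra h
    rw [not_nontrivial_iff_subsingleton] at h
    have h1 := hρ.trace_eq_one
    rw [Subsingleton.elim ρ 0] at h1
    simp [QuantumCharging.opTrace] at h1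
  subst hρa hσb
  have : Nonempty (Fin m) := by
    obtain ⟨j⟩ := a.toBasis.index_nonempty
    exact ⟨j.1⟩
  exact ciSup_le fun i => le_csInf (QuantumCharging.chargingTimes_nonempty r a b) fun T hT =>
    QuantumCharging.buresAngle_le_of_mem_chargingTimes hn hr a b hT i
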